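/- Let $p$ be an integer with $p\notin\{0,1,2,3\}$, let $f(x)=x^p$ on $(0,\infty)$, and for $c>0$ let $P_c(z)=\sum_{k=0}^{3}\frac{f^{(k)}(c)}{k!}(z-c)^k$ be the Taylor polynomial of $f$ of order $3$ at $c$. Then for all real $0<a<b$ the polynomial $P_b-P_a$ has a pair of nonreal roots $x_1\pm iy_1$ (with $x_1,y_1\in\mathbb{R}$, $y_1\neq 0$) such that $a<x_1<b$. Moreover, all nonreal roots of $P_b-P_a$ have this same real part $x_1$, so $M^3_{z^p}(a,b):=x_1$ is well defined for $0<a<b$. This gives a family of means, indexed by the countable set $\mathbb{Z}\setminus\{0,1,2,3\}$, where a mean is a function $M$ of pairs $0<a<b$ satisfying $a<M(a,b)<b$. -/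

import Mathlib

open Polynomial

/-- The Taylor polynomial of order `r` at `c` of a real function `f`, as a polynomial
in `ℝ[X]`: `∑_{k ≤ r} f⁽ᵏ⁾(c) / k! * (X - c)^k`. -/
noncomputable def taylorPoly (f : ℝ → ℝ) (r : ℕ) (c : ℝ) : ℝ[X] :=
  ∑ k ∈ Finset.range (r + 1),
    C (iteratedDeriv k f c / (k.factorial : ℝ)) * (X - C c) ^ k

/-- On the real line, `taylorPoly` is Mathlib's Taylor polynomial. -/
theorem eval_taylorPoly (f : ℝ → ℝ) (r : ℕ) (c x : ℝ) :
    (taylorPoly f r c).eval x = taylorWithinEval f r Set.univ c x := by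
  rw [taylor_within_apply, taylorPoly, eval_finsetSum]
  refine Finset.sum_congr rfl fun k _ => ?_
  simp only [eval_mul, eval_C, eval_pow, eval_sub, eval_X, iteratedDerivWithin_univ, smul_eq_mul]
  ring

/-- `z` is a nonreal root of the real polynomial `Q`. -/
def IsNonrealRoot (Q : ℝ[X]) (z : ℂ) : Prop :=
  z.im ≠ 0 ∧ aeval z Q = 0

/-- `M` is a (strict) mean of the pairs `0 < a < b`: `M a b` lies strictly between `a` and `b`. -/
def IsMean (M : ℝ → ℝ → ℝ) : Prop :=
  ∀ a b : ℝ, 0 < a → a < b → a < M a b ∧ M a b < b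

/-! Since the derivative of `P_c(z)` in `c` is `f⁗(c) (z - c)^3 / 3!`, the difference `P_b - P_a` is
a nonzero constant times `∫ (z - t)^3 t^q` over `[a, b]`, with `q = p - 4`. Its coefficients are
moments of `t^q`. Cauchy–Schwarz (`zpowMoment_sq_lt`) makes this cubic strictly increasing on the
real line, so it has one real root and one conjugate pair.

To locate the pair, expand about `a` with `N_k = ∫ (t - a)^k t^q`: by the Hurwitz criterion
`cubic_root_re_pos`, `N₀N₃ < 9N₁N₂` gives real part above `a`. Reflection treats `b`. Excluding `p =
0, 1, 2, 3` leaves `q ≥ 0` or `q ≤ -5`. When the weight does not decrease away from the end point,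
its mean is at least halfway along and crude bounds suffice; otherwise integration by parts and a
Chebyshev inequality are needed. -/

/-! ### Nonreal roots of real cubics -/

/-- The real and (reduced) imaginary parts of a cubic equation at a nonreal root. -/
theorem cubic_re_im {A B C D : ℝ} {z : ℂ} (hy : z.im ≠ 0)
    (hz : (A : ℂ) * z ^ 3 - 3 * B * z ^ 2 + 3 * C * z - D = 0) :
    D = A * (z.re ^ 3 - 3 * z.re * z.im ^ 2) - 3 * B * (z.re ^ 2 - z.im ^ 2) + 3 * C * z.re ∧
      3 * C = 6 * B * z.re - A * (3 * z.re ^ 2 - z.im ^ 2) := by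
  obtain ⟨x, y⟩ := z
  have h1 := congrArg Complex.re hz
  have h2 := congrArg Complex.im hz
  simp [pow_succ] at h1 h2 hy ⊢
  constructor
  · linear_combination -h1
  · apply mul_left_cancel₀ hy
    linear_combination h2

/-- A Hurwitz criterion: the nonreal roots of a real cubic lie in the right half-plane. -/
theorem cubic_root_re_pos {A B C D : ℝ} {z : ℂ} (hA : A ≠ 0) (hD : A * D < 9 * B * C)
    (hy : z.im ≠ 0) (hz : (A : ℂ) * z ^ 3 - 3 * B * z ^ 2 + 3 * C * z - D = 0) : 0 < z.re := by
  obtain ⟨h1, h2⟩ := cubic_re_im hy hz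
  have hpos : 0 < (3 * B - A * z.re) ^ 2 + A ^ 2 * z.im ^ 2 := by positivity
  -- By Vieta the real root `r` satisfies `A * r = 3 * B - 2 * A * z.re`, so the bracket is `A ^ 2 *
  -- |r + z| ^ 2`.
  have key : 9 * B * C - A * D = 2 * z.re * ((3 * B - A * z.re) ^ 2 + A ^ 2 * z.im ^ 2) := by
    linear_combination (3 * B - A * z.re) * h2 - A * h1
  by_contra! h
  nlinarith [mul_nonneg (neg_nonneg.2 h) hpos.le]

/-- In the variable `A * u - B` the cubic loses its square term. Its three roots then sum to zero,
so `2 * B - 2 * A * u.re` is its real root, which is unique by monotonicity. -/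
theorem cubic_root_re_unique {A B C D : ℝ} {z w : ℂ} (hA : A ≠ 0) (hV : B ^ 2 < A * C)
    (hz' : z.im ≠ 0) (hz : (A : ℂ) * z ^ 3 - 3 * B * z ^ 2 + 3 * C * z - D = 0)
    (hw' : w.im ≠ 0) (hw : (A : ℂ) * w ^ 3 - 3 * B * w ^ 2 + 3 * C * w - D = 0) :
    z.re = w.re := by
  have key : ∀ u : ℂ, u.im ≠ 0 → (A : ℂ) * u ^ 3 - 3 * B * u ^ 2 + 3 * C * u - D = 0 →
      (2 * B - 2 * A * u.re) ^ 3 + 3 * (A * C - B ^ 2) * (2 * B - 2 * A * u.re) =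
        A ^ 2 * D - 3 * A * B * C + 2 * B ^ 3 := by
    intro u hu' hu
    obtain ⟨h1, h2⟩ := cubic_re_im hu' hu
    linear_combination (-A ^ 2) * h1 + (3 * A * B - 3 * A ^ 2 * u.re) * h2
  have h1 := key z hz' hz
  have h2 := key w hw' hw
  set s := 2 * B - 2 * A * z.re with hs
  set t := 2 * B - 2 * A * w.re with ht
  have hpos : 0 < s ^ 2 + s * t + t ^ 2 + 3 * (A * C - B ^ 2) := by
    nlinarith [sq_nonneg (s + t), sq_nonneg s, sq_nonneg t]
  have h3 : (s - t) * (s ^ 2 + s * t + t ^ 2 + 3 * (A * C - B ^ 2)) = 0 := by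
    linear_combination h1 - h2
  have h4 : s - t = 0 := (mul_eq_zero.1 h3).resolve_right hpos.ne'
  apply mul_left_cancel₀ hA
  linarith

theorem exists_nonreal_cubic_root {A B C D r : ℝ} (hA : A ≠ 0) (hV : B ^ 2 < A * C)
    (hr : A * r ^ 3 - 3 * B * r ^ 2 + 3 * C * r - D = 0) :
    ∃ x y : ℝ, y ≠ 0 ∧
      (A : ℂ) * (x + y * Complex.I) ^ 3 - 3 * B * (x + y * Complex.I) ^ 2
        + 3 * C * (x + y * Complex.I) - D = 0 ∧
      (A : ℂ) * (x - y * Complex.I) ^ 3 - 3 * B * (x - y * Complex.I) ^ 2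
        + 3 * C * (x - y * Complex.I) - D = 0 := by
  have hs : 0 < 3 * (A * C - B ^ 2) + 3 / 4 * (A * r - B) ^ 2 := by
    nlinarith [sq_nonneg (A * r - B)]
  -- `v` is the imaginary part of the depressed cubic's nonreal root, after dividing out the real
  -- root `A * r - B`.
  obtain ⟨v, hv, hv2⟩ : ∃ v : ℝ, v ≠ 0 ∧
      v ^ 2 = 3 * (A * C - B ^ 2) + 3 / 4 * (A * r - B) ^ 2 :=
    ⟨√_, (Real.sqrt_pos.2 hs).ne', Real.sq_sqrt hs.le⟩
  obtain ⟨x, hx⟩ : ∃ x, x = (3 * B - A * r) / (2 * A) := ⟨_, rfl⟩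
  obtain ⟨y, hy⟩ : ∃ y, y = v / A := ⟨_, rfl⟩
  have hB : 3 * B = A * (r + 2 * x) := by rw [hx]; field_simp; ring
  have hB' : B = A * (r + 2 * x) / 3 := by linarith
  have hyv : v = A * y := by rw [hy]; field_simp
  have hC : 3 * C = A * (2 * r * x + x ^ 2 + y ^ 2) := by
    apply mul_left_cancel₀ hA
    rw [hyv, hB'] at hv2
    linear_combination -hv2
  have hD : D = A * (r * (x ^ 2 + y ^ 2)) := by
    linear_combination (-1 : ℝ) * hr - r ^ 2 * hB + r * hC
  have hI := Complex.I_sq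
  have hBc : (3 : ℂ) * B = A * (r + 2 * x) := by exact_mod_cast hB
  have hCc : (3 : ℂ) * C = A * (2 * r * x + x ^ 2 + y ^ 2) := by exact_mod_cast hC
  have hDc : (D : ℂ) = A * (r * (x ^ 2 + y ^ 2)) := by exact_mod_cast hD
  have fac : ∀ u : ℂ, (A : ℂ) * u ^ 3 - 3 * B * u ^ 2 + 3 * C * u - D =
      A * (u - r) * ((u - x) ^ 2 + y ^ 2) := by
    intro u
    rw [hBc, hCc, hDc]; ring
  refine ⟨x, y, by rw [hy]; positivity, ?_, ?_⟩
  · rw [fac]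
    linear_combination (A : ℂ) * (x + y * Complex.I - r) * y ^ 2 * hI
  · rw [fac]
    linear_combination (A : ℂ) * (x - y * Complex.I - r) * y ^ 2 * hI

/-! ### Moments of the power weight -/

/-- The power integral `∫ t in a..b, t ^ j`; `zpowMoment a b (q + k)` is the `k`-th moment of the
density `t ^ q` on `[a, b]`. -/
noncomputable def zpowMoment (a b : ℝ) (j : ℤ) : ℝ := ∫ t in a..b, t ^ j

section Moments

variable {a b : ℝ}

theorem zero_notMem_uIcc (ha : 0 < a) (hab : a < b) : (0 : ℝ) ∉ Set.uIcc a b := by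
  rw [Set.uIcc_of_le hab.le]
  exact fun h => absurd h.1 (not_le.2 ha)

/-- Keeping the factor `j + 1` on the left covers the logarithmic case `j = -1`, which occurs as `q
- 1` when `q = 0`. -/
theorem mul_zpowMoment (ha : 0 < a) (hab : a < b) (j : ℤ) :
    ((j : ℝ) + 1) * zpowMoment a b j = b ^ (j + 1) - a ^ (j + 1) := by
  rcases eq_or_ne j (-1) with rfl | hj
  · simp
  · have hj' : (j : ℝ) + 1 ≠ 0 := by
      intro h
      exact hj (by exact_mod_cast eq_neg_of_add_eq_zero_left h)
    rw [zpowMoment, integral_zpow (Or.inr ⟨hj, zero_notMem_uIcc ha hab⟩)]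
    field_simp

theorem continuousOn_zpow_Icc (ha : 0 < a) (j : ℤ) :
    ContinuousOn (fun t : ℝ => t ^ j) (Set.Icc a b) :=
  fun t ht => (continuousAt_zpow₀ t j (Or.inl (ha.trans_le ht.1).ne')).continuousWithinAt

theorem zpowMoment_cubic_pos (ha : 0 < a) (hab : a < b) (j : ℤ) (c₀ c₁ c₂ c₃ : ℝ)
    (h0 : ∀ t, a ≤ t → t ≤ b → 0 ≤ c₀ + c₁ * t + c₂ * t ^ 2 + c₃ * t ^ 3)
    (h1 : ∃ t, a ≤ t ∧ t ≤ b ∧ 0 < c₀ + c₁ * t + c₂ * t ^ 2 + c₃ * t ^ 3) :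
    0 < c₀ * zpowMoment a b j + c₁ * zpowMoment a b (j + 1) + c₂ * zpowMoment a b (j + 2)
      + c₃ * zpowMoment a b (j + 3) := by
  have hint : ∀ (c : ℝ) (i : ℤ),
      IntervalIntegrable (fun t : ℝ => c * t ^ i) MeasureTheory.volume a b := by
    intro c i
    apply ContinuousOn.intervalIntegrable
    rw [Set.uIcc_of_le hab.le]
    exact continuousOn_const.mul (continuousOn_zpow_Icc ha i)
  have hsum : c₀ * zpowMoment a b j + c₁ * zpowMoment a b (j + 1) + c₂ * zpowMoment a b (j + 2)
      + c₃ * zpowMoment a b (j + 3) =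
      ∫ t in a..b, (c₀ + c₁ * t + c₂ * t ^ 2 + c₃ * t ^ 3) * t ^ j := by
    simp only [zpowMoment]
    rw [← intervalIntegral.integral_const_mul, ← intervalIntegral.integral_const_mul,
      ← intervalIntegral.integral_const_mul, ← intervalIntegral.integral_const_mul,
      ← intervalIntegral.integral_add (hint _ _) (hint _ _),
      ← intervalIntegral.integral_add ((hint _ _).add (hint _ _)) (hint _ _),
      ← intervalIntegral.integral_add (((hint _ _).add (hint _ _)).add (hint _ _)) (hint _ _)]
    apply intervalIntegral.integral_congr
    intro t ht
    have ht0 : t ≠ 0 := fun h => zero_notMem_uIcc ha hab (h ▸ ht)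
    simp only [zpow_add₀ ht0]
    norm_cast
    ring
  rw [hsum]
  apply intervalIntegral.integral_pos hab
  · exact ContinuousOn.mul (by fun_prop) (continuousOn_zpow_Icc ha j)
  · intro t ht
    exact mul_nonneg (h0 t ht.1.le ht.2) (zpow_nonneg (ha.trans ht.1).le j)
  · obtain ⟨t, h2, h3, h4⟩ := h1
    exact ⟨t, ⟨h2, h3⟩, mul_pos h4 (zpow_pos (ha.trans_le h2) j)⟩

theorem zpowMoment_pos (ha : 0 < a) (hab : a < b) (j : ℤ) : 0 < zpowMoment a b j := by
  have := zpowMoment_cubic_pos ha hab j 1 0 0 0 (fun t _ _ => by norm_num)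
    ⟨a, le_rfl, hab.le, by norm_num⟩
  simpa using this

/-- The boundary values of the moments, in terms of `a ^ q` and `b ^ q`. -/
theorem zpowMoment_relations (ha : 0 < a) (hab : a < b) (q : ℤ) :
    (q : ℝ) * zpowMoment a b (q - 1) = b ^ q - a ^ q ∧
    ((q : ℝ) + 1) * zpowMoment a b q = b * b ^ q - a * a ^ q ∧
    ((q : ℝ) + 2) * zpowMoment a b (q + 1) = b ^ 2 * b ^ q - a ^ 2 * a ^ q ∧
    ((q : ℝ) + 3) * zpowMoment a b (q + 2) = b ^ 3 * b ^ q - a ^ 3 * a ^ q ∧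
    ((q : ℝ) + 4) * zpowMoment a b (q + 3) = b ^ 4 * b ^ q - a ^ 4 * a ^ q := by
  have hb : b ≠ 0 := (ha.trans hab).ne'
  have ha' : a ≠ 0 := ha.ne'
  have key : ∀ (n : ℕ), ((q : ℝ) + n + 1) * zpowMoment a b (q + n) =
      b ^ (n + 1) * b ^ q - a ^ (n + 1) * a ^ q := by
    intro n
    have h := mul_zpowMoment ha hab (q + n)
    push_cast at h
    rw [h, ← zpow_natCast b, ← zpow_natCast a, ← zpow_add₀ hb, ← zpow_add₀ ha']
    congr 2 <;> push_cast <;> ring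
  refine ⟨?_, ?_, ?_, ?_, ?_⟩
  · have h := mul_zpowMoment ha hab (q - 1)
    simpa using h
  · simpa using key 0
  · have h := key 1
    norm_num at h
    linear_combination h
  · have h := key 2
    norm_num at h
    linear_combination h
  · have h := key 3
    norm_num at h
    linear_combination h

theorem zpowMoment_pred_cubic_pos (ha : 0 < a) (hab : a < b) (q : ℤ) (c₀ c₁ c₂ c₃ : ℝ)
    (h0 : ∀ t, a ≤ t → t ≤ b → 0 ≤ c₀ + c₁ * t + c₂ * t ^ 2 + c₃ * t ^ 3)
    (h1 : ∃ t, a ≤ t ∧ t ≤ b ∧ 0 < c₀ + c₁ * t + c₂ * t ^ 2 + c₃ * t ^ 3) :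
    0 < c₀ * zpowMoment a b (q - 1) + c₁ * zpowMoment a b q + c₂ * zpowMoment a b (q + 1)
      + c₃ * zpowMoment a b (q + 2) := by
  have h := zpowMoment_cubic_pos ha hab (q - 1) c₀ c₁ c₂ c₃ h0 h1
  rwa [show q - 1 + 1 = q by ring, show q - 1 + 2 = q + 1 by ring,
    show q - 1 + 3 = q + 2 by ring] at h

theorem zpowMoment_sq_lt (ha : 0 < a) (hab : a < b) (q : ℤ) :
    zpowMoment a b (q + 1) ^ 2 < zpowMoment a b q * zpowMoment a b (q + 2) := by
  have hm := zpowMoment_pos ha hab q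
  -- `μ` is the mean of the weight; the inequality is positivity of its variance.
  set μ := zpowMoment a b (q + 1) / zpowMoment a b q with hμ
  have h := zpowMoment_cubic_pos ha hab q (μ ^ 2) (-2 * μ) 1 0
    (fun t _ _ => by nlinarith [sq_nonneg (t - μ)]) (by
      rcases eq_or_ne a μ with h | h
      · refine ⟨b, hab.le, le_rfl, ?_⟩
        have : 0 < (b - μ) ^ 2 := by rw [← h]; exact pow_pos (sub_pos.2 hab) 2
        linarith
      · refine ⟨a, le_rfl, hab.le, ?_⟩
        have : 0 < (a - μ) ^ 2 := by have := sub_ne_zero.2 h; positivity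
        linarith)
  have hm1 : zpowMoment a b (q + 1) = μ * zpowMoment a b q := by rw [hμ]; field_simp
  rw [hm1] at h ⊢
  nlinarith [mul_pos hm h]

/-! ### Moment inequalities at the end points -/

/-- The left-hand moments `∫ (t - a) ^ k * t ^ q`, `1 ≤ k ≤ 3`, their positivity and the bound
of the third by the second. -/
theorem left_moments_pos (ha : 0 < a) (hab : a < b) (q : ℤ) :
    0 < zpowMoment a b (q + 1) - a * zpowMoment a b q ∧
    0 < zpowMoment a b (q + 2) - 2 * a * zpowMoment a b (q + 1) + a ^ 2 * zpowMoment a b q ∧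
    0 < zpowMoment a b (q + 3) - 3 * a * zpowMoment a b (q + 2)
        + 3 * a ^ 2 * zpowMoment a b (q + 1) - a ^ 3 * zpowMoment a b q ∧
    zpowMoment a b (q + 3) - 3 * a * zpowMoment a b (q + 2)
        + 3 * a ^ 2 * zpowMoment a b (q + 1) - a ^ 3 * zpowMoment a b q <
      (b - a) * (zpowMoment a b (q + 2) - 2 * a * zpowMoment a b (q + 1)
        + a ^ 2 * zpowMoment a b q) := by
  have hL := sub_pos.2 hab
  refine ⟨?_, ?_, ?_, ?_⟩
  · have h := zpowMoment_cubic_pos ha hab q (-a) 1 0 0 (fun t h1 _ => by linarith)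
      ⟨b, hab.le, le_rfl, by linarith⟩
    linarith
  · have h := zpowMoment_cubic_pos ha hab q (a ^ 2) (-2 * a) 1 0
      (fun t h1 _ => by nlinarith [sq_nonneg (t - a)])
      ⟨b, hab.le, le_rfl, by nlinarith [pow_pos hL 2]⟩
    linarith
  · have h := zpowMoment_cubic_pos ha hab q (-a ^ 3) (3 * a ^ 2) (-3 * a) 1
      (fun t h1 _ => by linarith [pow_nonneg (sub_nonneg.2 h1) 3])
      ⟨b, hab.le, le_rfl, by linarith [pow_pos hL 3]⟩
    linarith
  · have h := zpowMoment_cubic_pos ha hab q (a ^ 2 * b) (-2 * a * b - a ^ 2) (b + 2 * a) (-1)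
      (fun t _ h2 => by linarith [mul_nonneg (sq_nonneg (t - a)) (sub_nonneg.2 h2)])
      ⟨(a + b) / 2, by linarith, by linarith, by linarith [pow_pos hL 3]⟩
    linarith

theorem right_moments_pos (ha : 0 < a) (hab : a < b) (q : ℤ) :
    0 < b * zpowMoment a b q - zpowMoment a b (q + 1) ∧
    0 < zpowMoment a b (q + 2) - 2 * b * zpowMoment a b (q + 1) + b ^ 2 * zpowMoment a b q ∧
    0 < b ^ 3 * zpowMoment a b q - 3 * b ^ 2 * zpowMoment a b (q + 1)
        + 3 * b * zpowMoment a b (q + 2) - zpowMoment a b (q + 3) ∧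
    b ^ 3 * zpowMoment a b q - 3 * b ^ 2 * zpowMoment a b (q + 1)
        + 3 * b * zpowMoment a b (q + 2) - zpowMoment a b (q + 3) <
      (b - a) * (zpowMoment a b (q + 2) - 2 * b * zpowMoment a b (q + 1)
        + b ^ 2 * zpowMoment a b q) := by
  have hL := sub_pos.2 hab
  refine ⟨?_, ?_, ?_, ?_⟩
  · have h := zpowMoment_cubic_pos ha hab q b (-1) 0 0 (fun t _ h2 => by linarith)
      ⟨a, le_rfl, hab.le, by linarith⟩
    linarith
  · have h := zpowMoment_cubic_pos ha hab q (b ^ 2) (-2 * b) 1 0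
      (fun t h1 _ => by nlinarith [sq_nonneg (t - b)])
      ⟨a, le_rfl, hab.le, by nlinarith [pow_pos hL 2]⟩
    linarith
  · have h := zpowMoment_cubic_pos ha hab q (b ^ 3) (-3 * b ^ 2) (3 * b) (-1)
      (fun t _ h2 => by linarith [pow_nonneg (sub_nonneg.2 h2) 3])
      ⟨a, le_rfl, hab.le, by linarith [pow_pos hL 3]⟩
    linarith
  · have h := zpowMoment_cubic_pos ha hab q (-a * b ^ 2) (b ^ 2 + 2 * a * b) (-a - 2 * b) 1
      (fun t h1 _ => by linarith [mul_nonneg (sq_nonneg (b - t)) (sub_nonneg.2 h1)])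
      ⟨(a + b) / 2, by linarith, by linarith, by linarith [pow_pos hL 3]⟩
    linarith

theorem mul_lt_nine_mul_of_half_le {L N₀ N₁ N₂ N₃ : ℝ} (h0 : 0 < N₀) (h1 : 0 < N₁) (h2 : 0 < N₂)
    (h3 : N₃ < L * N₂) (h : L * N₀ ≤ 2 * N₁) : N₀ * N₃ < 9 * N₁ * N₂ := by
  nlinarith [mul_lt_mul_of_pos_left h3 h0, mul_le_mul_of_nonneg_right h h2.le, mul_pos h1 h2]

/-- The moment inequality at the left end point that makes the real part exceed `a`. -/
theorem left_moments_lt (ha : 0 < a) (hab : a < b) {q : ℤ} (hq : 0 ≤ q ∨ q ≤ -5) :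
    zpowMoment a b q * (zpowMoment a b (q + 3) - 3 * a * zpowMoment a b (q + 2)
        + 3 * a ^ 2 * zpowMoment a b (q + 1) - a ^ 3 * zpowMoment a b q) <
      9 * (zpowMoment a b (q + 1) - a * zpowMoment a b q) *
        (zpowMoment a b (q + 2) - 2 * a * zpowMoment a b (q + 1)
          + a ^ 2 * zpowMoment a b q) := by
  obtain ⟨p1, p2, p3, p4⟩ := left_moments_pos ha hab q
  have p0 := zpowMoment_pos ha hab q
  obtain ⟨r0, r1, r2, r3, r4⟩ := zpowMoment_relations ha hab q
  have hL := sub_pos.2 hab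
  rcases hq with hq | hq
  · have hq' : (0 : ℝ) ≤ q := by exact_mod_cast hq
    refine mul_lt_nine_mul_of_half_le p0 p1 p2 p4 ?_
    -- The polynomial is `(t - a) * (b - t)`; it vanishes at both ends, so integrating it by parts
    -- against `q * t ^ (q - 1)` leaves `2 * N₁ - L * N₀`.
    have h := zpowMoment_pred_cubic_pos ha hab q (-(a * b)) (a + b) (-1) 0
      (fun t h1 h2 => by linarith [mul_nonneg (sub_nonneg.2 h1) (sub_nonneg.2 h2)])
      ⟨(a + b) / 2, by linarith, by linarith, by linarith [pow_pos hL 2]⟩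
    have := mul_nonneg hq' h.le
    linear_combination this - a * b * r0 + (a + b) * r1 - r2
  · have hq' : (q : ℝ) ≤ -5 := by exact_mod_cast hq
    have h := zpowMoment_pred_cubic_pos ha hab q (-(b - a) ^ 2 * a + a ^ 3)
      ((b - a) ^ 2 - 3 * a ^ 2) (3 * a) (-1)
      (fun t h1 h2 => by
        linarith [mul_nonneg (mul_nonneg (sub_nonneg.2 h1) (sub_nonneg.2 h2))
          (by linarith : 0 ≤ b + t - 2 * a)])
      ⟨(a + b) / 2, by linarith, by linarith, by linarith [pow_pos hL 3]⟩
    -- Chebyshev: the weight decreases while `(t - a) ^ 2` increases with average `(b - a) ^ 2 / 3`.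
    -- The proof integrates `(t - a) * ((b - a) ^ 2 - (t - a) ^ 2)`, zero at both ends, by parts.
    have hche : 0 < (b - a) ^ 2 * zpowMoment a b q - 3 * (zpowMoment a b (q + 2)
        - 2 * a * zpowMoment a b (q + 1) + a ^ 2 * zpowMoment a b q) := by
      have := mul_pos (by linarith : (0 : ℝ) < -q) h
      linear_combination this - (-(b - a) ^ 2 * a + a ^ 3) * r0
        - ((b - a) ^ 2 - 3 * a ^ 2) * r1 - 3 * a * r2 + r3
    set m₀ := zpowMoment a b q
    -- `e1` and `e3` integrate the derivatives of `(t - a) * t ^ (q + 1)` and `(t - a) ^ 3 * t ^ (q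
    -- + 1)`; `key` eliminates the terms carrying the factor `a`.
    have e1 : ((q : ℝ) + 2) * (zpowMoment a b (q + 1) - a * m₀) + a * m₀ =
        (b - a) * b * b ^ q := by
      linear_combination r2 - a * r1
    have e3 : ((q : ℝ) + 4) * (zpowMoment a b (q + 3) - 3 * a * zpowMoment a b (q + 2)
        + 3 * a ^ 2 * zpowMoment a b (q + 1) - a ^ 3 * m₀)
        + 3 * a * (zpowMoment a b (q + 2) - 2 * a * zpowMoment a b (q + 1) + a ^ 2 * m₀) =
        (b - a) ^ 2 * ((b - a) * b * b ^ q) := by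
      linear_combination r4 - 3 * a * r3 + 3 * a ^ 2 * r2 - a ^ 3 * r1
    have he : 0 < (b - a) * b * b ^ q :=
      mul_pos (mul_pos hL (ha.trans hab)) (zpow_pos (ha.trans hab) q)
    set e := (b - a) * b * b ^ q
    set N₁ := zpowMoment a b (q + 1) - a * m₀
    set N₂ := zpowMoment a b (q + 2) - 2 * a * zpowMoment a b (q + 1) + a ^ 2 * m₀
    set N₃ := zpowMoment a b (q + 3) - 3 * a * zpowMoment a b (q + 2)
        + 3 * a ^ 2 * zpowMoment a b (q + 1) - a ^ 3 * m₀
    have key : (-(q : ℝ) - 4) * (9 * N₁ * N₂ - m₀ * N₃) =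
        e * ((b - a) ^ 2 * m₀ - 3 * N₂) + 6 * (-(q : ℝ) - 5) * (N₁ * N₂) := by
      linear_combination m₀ * e3 - 3 * N₂ * e1
    have h6 : 0 < (-(q : ℝ) - 4) * (9 * N₁ * N₂ - m₀ * N₃) := by
      rw [key]
      -- At `q = -5` the second term vanishes, so strictness must come from the Chebyshev term.
      exact add_pos_of_pos_of_nonneg (mul_pos he hche)
        (mul_nonneg (by linarith) (mul_pos p1 p2).le)
    exact sub_pos.1 (pos_of_mul_pos_right h6 (by linarith))

/-- The moment inequality at the right end point that keeps the real part below `b`. -/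
theorem right_moments_lt (ha : 0 < a) (hab : a < b) {q : ℤ} (hq : 0 ≤ q ∨ q ≤ -5) :
    zpowMoment a b q * (b ^ 3 * zpowMoment a b q - 3 * b ^ 2 * zpowMoment a b (q + 1)
        + 3 * b * zpowMoment a b (q + 2) - zpowMoment a b (q + 3)) <
      9 * (b * zpowMoment a b q - zpowMoment a b (q + 1)) *
        (zpowMoment a b (q + 2) - 2 * b * zpowMoment a b (q + 1)
          + b ^ 2 * zpowMoment a b q) := by
  obtain ⟨p1, p2, p3, p4⟩ := right_moments_pos ha hab q
  have p0 := zpowMoment_pos ha hab q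
  obtain ⟨r0, r1, r2, r3, r4⟩ := zpowMoment_relations ha hab q
  have hL := sub_pos.2 hab
  rcases hq with hq | hq
  · have hq' : (0 : ℝ) ≤ q := by exact_mod_cast hq
    have h := zpowMoment_pred_cubic_pos ha hab q ((b - a) ^ 2 * b - b ^ 3)
      (-(b - a) ^ 2 + 3 * b ^ 2) (-3 * b) 1
      (fun t h1 h2 => by
        linarith [mul_nonneg (mul_nonneg (sub_nonneg.2 h1) (sub_nonneg.2 h2))
          (by linarith : 0 ≤ 2 * b - t - a)])
      ⟨(a + b) / 2, by linarith, by linarith, by linarith [pow_pos hL 3]⟩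
    have hche : 0 ≤ (b - a) ^ 2 * zpowMoment a b q - 3 * (zpowMoment a b (q + 2)
        - 2 * b * zpowMoment a b (q + 1) + b ^ 2 * zpowMoment a b q) := by
      have := mul_nonneg hq' h.le
      linear_combination this + ((b - a) ^ 2 * b - b ^ 3) * r0
        + (-(b - a) ^ 2 + 3 * b ^ 2) * r1 - 3 * b * r2 + r3
    set m₀ := zpowMoment a b q
    have e1 : ((q : ℝ) + 2) * (b * m₀ - zpowMoment a b (q + 1)) =
        b * m₀ - (b - a) * a * a ^ q := by
      linear_combination b * r1 - r2
    have e3 : ((q : ℝ) + 4) * (b ^ 3 * m₀ - 3 * b ^ 2 * zpowMoment a b (q + 1)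
        + 3 * b * zpowMoment a b (q + 2) - zpowMoment a b (q + 3)) =
        3 * b * (zpowMoment a b (q + 2) - 2 * b * zpowMoment a b (q + 1) + b ^ 2 * m₀) -
        (b - a) ^ 2 * ((b - a) * a * a ^ q) := by
      linear_combination b ^ 3 * r1 - 3 * b ^ 2 * r2 + 3 * b * r3 - r4
    have he : 0 < (b - a) * a * a ^ q := mul_pos (mul_pos hL ha) (zpow_pos ha q)
    set e := (b - a) * a * a ^ q
    set N₁ := b * m₀ - zpowMoment a b (q + 1)
    set N₂ := zpowMoment a b (q + 2) - 2 * b * zpowMoment a b (q + 1) + b ^ 2 * m₀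
    set N₃ := b ^ 3 * m₀ - 3 * b ^ 2 * zpowMoment a b (q + 1)
        + 3 * b * zpowMoment a b (q + 2) - zpowMoment a b (q + 3)
    have key : ((q : ℝ) + 4) * (9 * N₁ * N₂ - m₀ * N₃) =
        e * ((b - a) ^ 2 * m₀ - 3 * N₂) + 6 * ((q : ℝ) + 5) * (N₁ * N₂) := by
      linear_combination 3 * N₂ * e1 - m₀ * e3
    have h6 : 0 < ((q : ℝ) + 4) * (9 * N₁ * N₂ - m₀ * N₃) := by
      rw [key]
      -- Here the Chebyshev term vanishes at `q = 0` (constant weight), and strictness comes from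
      -- `N₁ * N₂`.
      exact add_pos_of_nonneg_of_pos (mul_nonneg he.le hche)
        (mul_pos (by linarith) (mul_pos p1 p2))
    exact sub_pos.1 (pos_of_mul_pos_right h6 (by linarith))
  · have hq' : (q : ℝ) ≤ -5 := by exact_mod_cast hq
    refine mul_lt_nine_mul_of_half_le p0 p1 p2 p4 ?_
    have h := zpowMoment_pred_cubic_pos ha hab q (-(a * b)) (a + b) (-1) 0
      (fun t h1 h2 => by linarith [mul_nonneg (sub_nonneg.2 h1) (sub_nonneg.2 h2)])
      ⟨(a + b) / 2, by linarith, by linarith, by linarith [pow_pos hL 2]⟩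
    have := mul_nonneg (by linarith : (0 : ℝ) ≤ -q) h.le
    linear_combination this + a * b * r0 - (a + b) * r1 + r2

end Moments

/-! ### The Taylor difference as a moment cubic -/

theorem aeval_taylorPoly_zpow (p : ℤ) {c : ℝ} (hc : c ≠ 0) (z : ℂ) :
    aeval z (taylorPoly (fun x => x ^ p) 3 c) =
      ((c ^ (p - 4) : ℝ) : ℂ) * (c ^ 4 + p * c ^ 3 * (z - c)
        + p * (p - 1) / 2 * c ^ 2 * (z - c) ^ 2
        + p * (p - 1) * (p - 2) / 6 * c * (z - c) ^ 3) := by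
  have h0 : c ^ p = c ^ (p - 4) * c ^ 4 := by
    rw [← zpow_natCast, ← zpow_add₀ hc]; congr 1; push_cast; ring
  have h1 : c ^ (p - 1) = c ^ (p - 4) * c ^ 3 := by
    rw [← zpow_natCast, ← zpow_add₀ hc]; congr 1; push_cast; ring
  have h2 : c ^ (p - 2) = c ^ (p - 4) * c ^ 2 := by
    rw [← zpow_natCast, ← zpow_add₀ hc]; congr 1; push_cast; ring
  have h3 : c ^ (p - 3) = c ^ (p - 4) * c := by
    rw [← zpow_add_one₀ hc]; congr 1; ring
  simp only [taylorPoly, Finset.sum_range_succ, Finset.sum_range_zero, iteratedDeriv_eq_iterate,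
    iter_deriv_zpow, Finset.prod_range_succ, Finset.prod_range_zero, map_zero, map_add, map_mul,
    map_pow,
    map_sub, aeval_C, aeval_X, Nat.factorial, Nat.cast_ofNat, Nat.cast_zero, Nat.cast_one,
    sub_zero, h0, h1, h2, h3, Complex.coe_algebraMap]
  push_cast
  ring

theorem aeval_taylorPoly_sub (p : ℤ) {a b : ℝ} (ha : 0 < a) (hab : a < b) (z : ℂ) :
    aeval z (taylorPoly (fun x => x ^ p) 3 b - taylorPoly (fun x => x ^ p) 3 a) =
      ((p * (p - 1) * (p - 2) * (p - 3) / 6 : ℝ) : ℂ) *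
        ((zpowMoment a b (p - 4) : ℂ) * z ^ 3 - 3 * zpowMoment a b (p - 4 + 1) * z ^ 2
          + 3 * zpowMoment a b (p - 4 + 2) * z - zpowMoment a b (p - 4 + 3)) := by
  rw [map_sub, aeval_taylorPoly_zpow p ha.ne', aeval_taylorPoly_zpow p (ha.trans hab).ne']
  obtain ⟨-, r1, r2, r3, r4⟩ := zpowMoment_relations ha hab (p - 4)
  have r1' := congrArg (Complex.ofReal) r1
  have r2' := congrArg (Complex.ofReal) r2
  have r3' := congrArg (Complex.ofReal) r3
  have r4' := congrArg (Complex.ofReal) r4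
  push_cast at r1' r2' r3' r4' ⊢
  linear_combination (-(p : ℂ) * (p - 1) * (p - 2) / 6 * z ^ 3) * r1'
    + ((p : ℂ) * (p - 1) * (p - 3) / 2 * z ^ 2) * r2'
    - ((p : ℂ) * (p - 2) * (p - 3) / 2 * z) * r3'
    + ((p - 1 : ℂ) * (p - 2) * (p - 3) / 6) * r4'

theorem isNonrealRoot_taylorPoly_sub_iff {p : ℤ} (hp : p ∉ ({0, 1, 2, 3} : Set ℤ)) {a b : ℝ}
    (ha : 0 < a) (hab : a < b) (z : ℂ) :
    IsNonrealRoot (taylorPoly (fun x => x ^ p) 3 b - taylorPoly (fun x => x ^ p) 3 a) z ↔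
      z.im ≠ 0 ∧ (zpowMoment a b (p - 4) : ℂ) * z ^ 3 - 3 * zpowMoment a b (p - 4 + 1) * z ^ 2
          + 3 * zpowMoment a b (p - 4 + 2) * z - zpowMoment a b (p - 4 + 3) = 0 := by
  have hK : ((p * (p - 1) * (p - 2) * (p - 3) / 6 : ℝ) : ℂ) ≠ 0 := by
    simp only [Set.mem_insert_iff, Set.mem_singleton_iff, not_or] at hp
    obtain ⟨h0, h1, h2, h3⟩ := hp
    have h : p * (p - 1) * (p - 2) * (p - 3) ≠ 0 :=
      mul_ne_zero (mul_ne_zero (mul_ne_zero h0 (sub_ne_zero.2 h1)) (sub_ne_zero.2 h2))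
        (sub_ne_zero.2 h3)
    have h' : (p * (p - 1) * (p - 2) * (p - 3) : ℝ) ≠ 0 := by exact_mod_cast h
    exact Complex.ofReal_ne_zero.2 (div_ne_zero h' (by norm_num))
  rw [IsNonrealRoot, aeval_taylorPoly_sub p ha hab, mul_eq_zero, or_iff_right hK]

theorem exists_nonrealRoot_pair {p : ℤ} (hp : p ∉ ({0, 1, 2, 3} : Set ℤ)) {a b : ℝ}
    (ha : 0 < a) (hab : a < b) :
    ∃ x₁ y₁ : ℝ,
      IsNonrealRoot (taylorPoly (fun x => x ^ p) 3 b - taylorPoly (fun x => x ^ p) 3 a)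
        ((x₁ : ℂ) + (y₁ : ℂ) * Complex.I) ∧
      IsNonrealRoot (taylorPoly (fun x => x ^ p) 3 b - taylorPoly (fun x => x ^ p) 3 a)
        ((x₁ : ℂ) - (y₁ : ℂ) * Complex.I) ∧
      a < x₁ ∧ x₁ < b := by
  have hq : 0 ≤ p - 4 ∨ p - 4 ≤ -5 := by
    simp only [Set.mem_insert_iff, Set.mem_singleton_iff, not_or] at hp
    omega
  have hleft := left_moments_lt ha hab hq
  have hright := right_moments_lt ha hab hq
  have p0 := zpowMoment_pos ha hab (p - 4)
  have hV := zpowMoment_sq_lt ha hab (p - 4)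
  obtain ⟨-, -, hqa, -⟩ := left_moments_pos ha hab (p - 4)
  obtain ⟨-, -, hqb, -⟩ := right_moments_pos ha hab (p - 4)
  simp only [isNonrealRoot_taylorPoly_sub_iff hp ha hab]
  set m₀ := zpowMoment a b (p - 4)
  set m₁ := zpowMoment a b (p - 4 + 1)
  set m₂ := zpowMoment a b (p - 4 + 2)
  set m₃ := zpowMoment a b (p - 4 + 3)
  -- The cubic is `∫ (x - t)^3 t^q`, negative at `a` and positive at `b`.
  obtain ⟨r, -, hr⟩ := intermediate_value_Icc hab.le
    (f := fun x => m₀ * x ^ 3 - 3 * m₁ * x ^ 2 + 3 * m₂ * x - m₃) (by fun_prop)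
    (show (0 : ℝ) ∈ Set.Icc _ _ from ⟨by linarith, by linarith⟩)
  obtain ⟨x, y, hy, h1, h2⟩ := exists_nonreal_cubic_root p0.ne' hV hr
  refine ⟨x, y, ⟨by simpa using hy, h1⟩, ⟨by simpa using hy, h2⟩, ?_, ?_⟩
  · have h := cubic_root_re_pos (z := x + y * Complex.I - a) p0.ne' hleft (by simpa using hy) (by
      push_cast
      linear_combination h1)
    simpa using h
  · have h := cubic_root_re_pos (z := b - (x + y * Complex.I)) p0.ne' hright (by simpa using hy) (by
      push_cast
      linear_combination -h1)
    simpa using h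

theorem theorem1 :
    (∀ p : ℤ, p ∉ ({0, 1, 2, 3} : Set ℤ) → ∀ a b : ℝ, 0 < a → a < b →
      ∃ x₁ y₁ : ℝ,
        IsNonrealRoot (taylorPoly (fun x => x ^ p) 3 b - taylorPoly (fun x => x ^ p) 3 a)
          ((x₁ : ℂ) + (y₁ : ℂ) * Complex.I) ∧
        IsNonrealRoot (taylorPoly (fun x => x ^ p) 3 b - taylorPoly (fun x => x ^ p) 3 a)
          ((x₁ : ℂ) - (y₁ : ℂ) * Complex.I) ∧
        a < x₁ ∧ x₁ < b) ∧
    (∃ M : {p : ℤ // p ∉ ({0, 1, 2, 3} : Set ℤ)} → ℝ → ℝ → ℝ,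
      ∀ p, IsMean (M p) ∧
        ∀ a b : ℝ, 0 < a → a < b → ∀ z : ℂ,
          IsNonrealRoot
            (taylorPoly (fun x => x ^ (p : ℤ)) 3 b - taylorPoly (fun x => x ^ (p : ℤ)) 3 a) z →
          z.re = M p a b) := by
  refine ⟨fun p hp a b ha hab => exists_nonrealRoot_pair hp ha hab, ?_⟩
  have hex : ∀ (p : {p : ℤ // p ∉ ({0, 1, 2, 3} : Set ℤ)}) (a b : ℝ), ∃ x : ℝ, 0 < a → a < b →
      (a < x ∧ x < b) ∧ ∀ z : ℂ, IsNonrealRoot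
        (taylorPoly (fun x => x ^ (p : ℤ)) 3 b - taylorPoly (fun x => x ^ (p : ℤ)) 3 a) z →
        z.re = x := by
    intro p a b
    by_cases h : 0 < a ∧ a < b
    · obtain ⟨ha, hab⟩ := h
      obtain ⟨x, y, hxy, -, hx⟩ := exists_nonrealRoot_pair p.2 ha hab
      refine ⟨x, fun _ _ => ⟨hx, fun z hz => ?_⟩⟩
      rw [isNonrealRoot_taylorPoly_sub_iff p.2 ha hab] at hz hxy
      have := cubic_root_re_unique (zpowMoment_pos ha hab _).ne' (zpowMoment_sq_lt ha hab _)
        hz.1 hz.2 hxy.1 hxy.2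
      simpa using this
    -- Outside `0 < a < b` the mean takes the irrelevant value `0`, so that `choose` gives a total
    -- function.
    · exact ⟨0, fun ha hab => absurd ⟨ha, hab⟩ h⟩
  choose M hM using hex
  exact ⟨M, fun p => ⟨fun a b ha hab => (hM p a b ha hab).1,
    fun a b ha hab => (hM p a b ha hab).2⟩⟩
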